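/- Let $\mathrm{Ai}$ be the Airy function of the first kind, i.e. the solution of $y''=xy$ with $\mathrm{Ai}(0)=\frac{1}{3^{2/3}\Gamma(2/3)}$ and $\mathrm{Ai}'(0)=-\frac{1}{3^{1/3}\Gamma(1/3)}$, and let $M_{1/3}(x)=3^{2/3}\,\mathrm{Ai}(x/3^{1/3})$ for $x\ge 0$. The $M$-Wright distribution $\nu_{1/3}$ is the measure $M_{1/3}(x)\,dx$ on $\mathbb{R}_+=[0,\infty)$. Let $C_b^2(\mathbb{R}_+)$ be the space of twice continuously differentiable functions $f:\mathbb{R}_+\to\mathbb{R}$ (one-sided derivatives at $0$) such that $f,f',f''$ are bounded, and let $$\mathcal{D}_{1/3}=\Big\{f\in C_b^2(\mathbb{R}_+)\;:\;\frac{f'(0)}{\Gamma(2/3)}+\frac{f(0)}{\Gamma(1/3)}=0\Big\},\qquad (\mathcal{A}_{1/3}f)(x)=f''(x)-\tfrac13\,x f(x),\quad x\ge 0.$$ Let $X$ be a real random variable with $X\ge 0$ almost surely. Then $X$ has the distribution $\nu_{1/3}$ if and only if, for every $f\in\mathcal{D}_{1/3}$, the random variable $(\mathcal{A}_{1/3}f)(X)$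 is integrable and $\mathbb{E}\big[(\mathcal{A}_{1/3}f)(X)\big]=0$. -/

import Mathlib

open MeasureTheory Set

noncomputable section

namespace MWright

/-- The solution of `y'' = x y` with `y 0 = 1`, `y' 0 = 0`:
`1 + x³/(2·3) + x⁶/((2·3)(5·6)) + ⋯`. -/
def airySeries₀ (x : ℝ) : ℝ :=
  ∑' k : ℕ, x ^ (3 * k) / ∏ j ∈ Finset.range k, ((3 * (j : ℝ) + 2) * (3 * (j : ℝ) + 3))

/-- The solution of `y'' = x y` with `y 0 = 0`, `y' 0 = 1`:
`x + x⁴/(3·4) + x⁷/((3·4)(6·7)) + ⋯`. -/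
def airySeries₁ (x : ℝ) : ℝ :=
  ∑' k : ℕ, x ^ (3 * k + 1) / ∏ j ∈ Finset.range k, ((3 * (j : ℝ) + 3) * (3 * (j : ℝ) + 4))

/-- The Airy function of the first kind on the real line: the solution of `y'' = x y` with
`Ai 0 = 1 / (3^(2/3) Γ(2/3))` and `Ai' 0 = -1 / (3^(1/3) Γ(1/3))`, given by its
(everywhere convergent) Maclaurin series. -/
def Ai (x : ℝ) : ℝ :=
  1 / ((3 : ℝ) ^ (2 / 3 : ℝ) * Real.Gamma (2 / 3)) * airySeries₀ x
    - 1 / ((3 : ℝ) ^ (1 / 3 : ℝ) * Real.Gamma (1 / 3)) * airySeries₁ x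

/-- The `M`-Wright density `M_{1/3}(x) = 3^(2/3) Ai(x / 3^(1/3))` (used for `x ≥ 0`). -/
def density (x : ℝ) : ℝ :=
  (3 : ℝ) ^ (2 / 3 : ℝ) * Ai (x / (3 : ℝ) ^ (1 / 3 : ℝ))

/-- The `M`-Wright distribution `M_{1/3}(x) dx` on `[0, ∞)`, as a measure on `ℝ`. -/
def law : Measure ℝ :=
  (volume.restrict (Ici 0)).withDensity fun x => ENNReal.ofReal (density x)

/-- `f ∈ C_b²([0, ∞))`: `f` is twice continuously differentiable on `[0, ∞)` (one-sidedly
at `0`) and `f`, `f'`, `f''` are bounded there. Values of `f` off `[0, ∞)` play no role. -/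
def IsCb2 (f : ℝ → ℝ) : Prop :=
  ContDiffOn ℝ 2 f (Ici 0) ∧
    ∃ C : ℝ, ∀ x ∈ Ici (0 : ℝ),
      |f x| ≤ C ∧ |derivWithin f (Ici 0) x| ≤ C ∧ |iteratedDerivWithin 2 f (Ici 0) x| ≤ C

/-- The domain of the Stein operator: `f ∈ C_b²([0, ∞))` with
`f'(0) / Γ(2/3) + f(0) / Γ(1/3) = 0`, that is `f'(0) M_{1/3}(0) - f(0) M_{1/3}'(0) = 0`. -/
def steinDomain : Set (ℝ → ℝ) :=
  {f | IsCb2 f ∧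
    derivWithin f (Ici 0) 0 / Real.Gamma (2 / 3) + f 0 / Real.Gamma (1 / 3) = 0}

/-- The Stein operator `(A f)(x) = f''(x) - x f(x) / 3`, `x ≥ 0`. -/
def steinOp (f : ℝ → ℝ) (x : ℝ) : ℝ :=
  iteratedDerivWithin 2 f (Ici 0) x - 1 / 3 * x * f x

end MWright

end

/-! Write `M` for the density. It satisfies `M'' = x M / 3`, so `(A f) M = (f' M - f M')'`. The
domain condition says that this boundary form vanishes at `0`, and `M`, `M'` tend to `0` at
infinity, so `A f` has mean zero (`integral_steinOp_law`). Conversely, for `h` continuous, compactly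
supported and of mean zero under the law, `A f = h` is solved by reduction of order, `f = M g` with
`(M² g')' = h M` (`exists_steinOp_eq`). Hence `E h(X) = 0` for every such `h`, which determines a
probability measure (`eq_of_forall_integral_eq_zero`). The analytic input is that `M` is positive,
has mass one and decays together with `M'`. With `L(z) = ∫₀^∞ e^{-t³ - z t} dt` and `ω = e^{iπ/3}`,
one has `M(x) = (3/π) Im (ω L(ω x))` (`density_eq_cubicLaplace`). Decay comes from bounds on `L` and
its derivatives for `Re z > 0`, the mass from rotating a primitive of `L` through the angle `π/3`,
and positivity from the ODE. -/

noncomputable section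

namespace MWright

open Filter Topology

/-! ### The cubic Laplace transform: convergence, derivatives, bounds, power series -/

/-- The entire function `z ↦ ∫₀^∞ tⁿ e^{-t³ - z t} dt`. -/
def cubicLaplace (n : ℕ) (z : ℂ) : ℂ :=
  ∫ t in Ioi (0 : ℝ), (t : ℂ) ^ n * Complex.exp (-(t : ℂ) ^ 3 - z * t)

lemma norm_cubicLaplace_integrand (n : ℕ) (z : ℂ) {t : ℝ} (ht : 0 < t) :
    ‖(t : ℂ) ^ n * Complex.exp (-(t : ℂ) ^ 3 - z * t)‖
      = t ^ n * Real.exp (-t ^ 3 - z.re * t) := by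
  rw [norm_mul, norm_pow, Complex.norm_real, Real.norm_of_nonneg ht.le, Complex.norm_exp]
  congr 2
  have : ((t : ℂ) ^ 3).re = t ^ 3 := by rw [← Complex.ofReal_pow, Complex.ofReal_re]
  simp [this]

/-- With `a = |c| + 1`, `c t - t³ ≤ a² - t`: either `t ≤ a` and `a t ≤ a²`, or `t ≥ a ≥ 1` and `t³ ≥
a t`. -/
lemma integrableOn_exp_mul_sub_cube (c : ℝ) :
    IntegrableOn (fun t : ℝ => Real.exp (c * t - t ^ 3)) (Ioi 0) := by
  have h1 : IntegrableOn (fun t : ℝ => Real.exp ((|c| + 1) ^ 2) * Real.exp (-t)) (Ioi 0) :=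
    (integrableOn_exp_neg_Ioi 0).const_mul _
  refine h1.mono' (by fun_prop) ?_
  refine (ae_restrict_iff' measurableSet_Ioi).2 (.of_forall fun t ht => ?_)
  have ht : 0 < t := ht
  rw [Real.norm_of_nonneg (Real.exp_pos _).le, ← Real.exp_add, Real.exp_le_exp]
  have hc : c * t ≤ |c| * t := mul_le_mul_of_nonneg_right (le_abs_self c) ht.le
  have hc0 := abs_nonneg c
  rcases le_total t (|c| + 1) with h | h
  · nlinarith [pow_pos ht 3]
  · nlinarith [mul_nonneg (sq_nonneg t) (sub_nonneg.2 ((by linarith : (1 : ℝ) ≤ t))),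
      mul_nonneg ht.le (sub_nonneg.2 h), sq_nonneg (|c| + 1)]

lemma integrableOn_pow_mul_exp_mul_sub_cube (n : ℕ) (c : ℝ) :
    IntegrableOn (fun t : ℝ => t ^ n * Real.exp (-t ^ 3 - c * t)) (Ioi 0) := by
  refine ((integrableOn_exp_mul_sub_cube (1 - c)).const_mul (n.factorial : ℝ)).mono'
    (by fun_prop) ?_
  refine (ae_restrict_iff' measurableSet_Ioi).2 (.of_forall fun t ht => ?_)
  have ht : 0 < t := ht
  rw [Real.norm_of_nonneg (by positivity)]
  have h := Real.pow_div_factorial_le_exp t ht.le n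
  rw [div_le_iff₀ (by positivity)] at h
  calc t ^ n * Real.exp (-t ^ 3 - c * t)
      ≤ Real.exp t * n.factorial * Real.exp (-t ^ 3 - c * t) := by gcongr
    _ = n.factorial * (Real.exp t * Real.exp (-t ^ 3 - c * t)) := by ring
    _ = _ := by rw [← Real.exp_add]; ring_nf

lemma integrableOn_cubicLaplace (n : ℕ) (z : ℂ) :
    IntegrableOn (fun t : ℝ => (t : ℂ) ^ n * Complex.exp (-(t : ℂ) ^ 3 - z * t)) (Ioi 0) := by
  refine (integrableOn_pow_mul_exp_mul_sub_cube n z.re).mono' (by fun_prop) ?_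
  exact (ae_restrict_iff' measurableSet_Ioi).2
    (.of_forall fun t ht => (norm_cubicLaplace_integrand n z ht).le)

lemma hasDerivAt_cubicLaplace (n : ℕ) (z : ℂ) :
    HasDerivAt (cubicLaplace n) (-cubicLaplace (n + 1) z) z := by
  have key := (hasDerivAt_integral_of_dominated_loc_of_deriv_le (μ := volume.restrict (Ioi (0 : ℝ)))
    (F := fun (z : ℂ) (t : ℝ) => (t : ℂ) ^ n * Complex.exp (-(t : ℂ) ^ 3 - z * t))
    (F' := fun (z : ℂ) (t : ℝ) => -((t : ℂ) ^ (n + 1) * Complex.exp (-(t : ℂ) ^ 3 - z * t)))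
    -- On the unit ball around `z` the real part is at least `z.re - 1`.
    (bound := fun t => t ^ (n + 1) * Real.exp (-t ^ 3 - (z.re - 1) * t))
    (Metric.ball_mem_nhds z one_pos) (.of_forall fun w => by fun_prop)
    (integrableOn_cubicLaplace n z) (by fun_prop) ?_
    (integrableOn_pow_mul_exp_mul_sub_cube (n + 1) _) ?_).2
  · rw [integral_neg] at key
    exact key
  · refine (ae_restrict_iff' measurableSet_Ioi).2 (.of_forall fun t ht w hw => ?_)
    have ht : 0 < t := ht
    rw [norm_neg, norm_cubicLaplace_integrand _ _ ht]
    have hre : z.re - 1 ≤ w.re := by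
      have := (Complex.abs_re_le_norm (w - z)).trans (mem_ball_iff_norm.1 hw).le
      rw [Complex.sub_re] at this
      linarith [(abs_le.1 this).1]
    gcongr
  · refine .of_forall fun t w _ => ?_
    have h1 : HasDerivAt (fun w : ℂ => -(t : ℂ) ^ 3 - w * t) (-(1 * (t : ℂ))) w :=
      ((hasDerivAt_id w).mul_const (t : ℂ)).const_sub _
    refine (h1.cexp.const_mul ((t : ℂ) ^ n)).congr_deriv ?_
    ring

/-- Dropping `e^{-t³} ≤ 1` leaves a Gamma integral. -/
lemma norm_cubicLaplace_le (n : ℕ) {z : ℂ} (hz : 0 < z.re) :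
    ‖cubicLaplace n z‖ ≤ n.factorial / z.re ^ (n + 1) := by
  have hint := Real.integral_rpow_mul_exp_neg_mul_Ioi (a := n + 1) (r := z.re) (by positivity) hz
  have h1 : IntegrableOn (fun t : ℝ => t ^ n * Real.exp (-(z.re * t))) (Ioi 0) := by
    have := integrableOn_rpow_mul_exp_neg_mul_rpow (p := 1) (s := n) (b := z.re)
      (by have := n.cast_nonneg (α := ℝ); linarith) one_pos hz
    simpa using this
  have h2 : ∫ t in Ioi (0 : ℝ), t ^ n * Real.exp (-(z.re * t)) = n.factorial / z.re ^ (n + 1) := by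
    have : ((1 : ℝ) / z.re) ^ ((n : ℝ) + 1) = 1 / z.re ^ (n + 1) := by
      rw [show ((n : ℝ) + 1) = ((n + 1 : ℕ) : ℝ) by push_cast; ring, Real.rpow_natCast]
      simp
    rw [this, Real.Gamma_nat_eq_factorial] at hint
    simp only [add_sub_cancel_right, Real.rpow_natCast] at hint
    rw [hint]; ring
  rw [← h2]
  refine norm_integral_le_of_norm_le h1 ?_
  refine (ae_restrict_iff' measurableSet_Ioi).2 (.of_forall fun t ht => ?_)
  have ht : 0 < t := ht
  rw [norm_cubicLaplace_integrand _ _ ht]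
  gcongr
  linarith [pow_pos ht 3]

/-- The inhomogeneous Airy equation satisfied by `cubicLaplace 0`, whose second derivative
is `cubicLaplace 2`. -/
lemma three_mul_cubicLaplace_two_add (z : ℂ) :
    3 * cubicLaplace 2 z + z * cubicLaplace 0 z = 1 := by
  have h2 := (integrableOn_cubicLaplace 2 z).const_mul 3
  have h0 := (integrableOn_cubicLaplace 0 z).const_mul z
  -- The combined integrand is an exact derivative; the primitive is `-1` at `0`, whence the
  -- right-hand side `1`.
  have hder : ∀ t ∈ Ici (0 : ℝ), HasDerivAt (fun t : ℝ => -Complex.exp (-(t : ℂ) ^ 3 - z * t))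
      (3 * ((t : ℂ) ^ 2 * Complex.exp (-(t : ℂ) ^ 3 - z * t))
        + z * ((t : ℂ) ^ 0 * Complex.exp (-(t : ℂ) ^ 3 - z * t))) t := by
    intro t _
    have h : HasDerivAt (fun t : ℂ => -Complex.exp (-t ^ 3 - z * t))
        (-(Complex.exp (-(t : ℂ) ^ 3 - z * t) * (-(3 * (t : ℂ) ^ 2) - z))) (t : ℂ) := by
      have h1 : HasDerivAt (fun t : ℂ => -t ^ 3 - z * t) (-(3 * (t : ℂ) ^ 2) - z) (t : ℂ) := by
        refine ((hasDerivAt_pow 3 (t : ℂ)).fun_neg.fun_sub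
          ((hasDerivAt_id' (t : ℂ)).const_mul z)).congr_deriv ?_
        norm_num
      exact h1.cexp.neg
    refine h.comp_ofReal.congr_deriv ?_
    ring
  have hlim : Tendsto (fun t : ℝ => -Complex.exp (-(t : ℂ) ^ 3 - z * t)) atTop (𝓝 0) := by
    rw [← neg_zero]
    refine Tendsto.neg (tendsto_zero_iff_norm_tendsto_zero.2 ?_)
    have hb : Tendsto (fun t : ℝ => Real.exp (-t)) atTop (𝓝 0) :=
      Real.tendsto_exp_neg_atTop_nhds_zero
    refine squeeze_zero' (.of_forall fun _ => norm_nonneg _) ?_ hb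
    filter_upwards [eventually_ge_atTop (1 + |z.re|)] with t ht
    have hz := abs_nonneg z.re
    have ht0 : 0 < t := by linarith
    have hn := norm_cubicLaplace_integrand 0 z ht0
    simp only [pow_zero, one_mul] at hn
    rw [hn, Real.exp_le_exp]
    nlinarith [neg_abs_le z.re, mul_nonneg (sq_nonneg t) (by linarith : (0 : ℝ) ≤ t - 1),
      mul_nonneg ht0.le (sub_nonneg.2 ht)]
  have h := integral_Ioi_of_hasDerivAt_of_tendsto' hder (h2.add h0) hlim
  rw [integral_add h2 h0, integral_const_mul, integral_const_mul] at h
  simpa [cubicLaplace] using h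

/-- Expand `e^{-z t}` and integrate termwise; the absolute series sums to `e^{‖z‖ t - t³}`, which is
integrable. -/
lemma hasSum_cubicLaplace_zero (z : ℂ) :
    HasSum (fun n : ℕ => (-z) ^ n / n.factorial * (Real.Gamma ((n + 1) / 3) / 3 : ℝ))
      (cubicLaplace 0 z) := by
  have key := hasSum_integral_of_dominated_convergence (μ := volume.restrict (Ioi (0 : ℝ)))
    (F := fun (n : ℕ) (t : ℝ) => (-z) ^ n / n.factorial * (((t : ℝ) ^ n * Real.exp (-t ^ 3) : ℝ) : ℂ))
    (f := fun t : ℝ => (t : ℂ) ^ 0 * Complex.exp (-(t : ℂ) ^ 3 - z * t))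
    (fun n t => (‖z‖ * t) ^ n / n.factorial * Real.exp (-t ^ 3))
    (fun n => by fun_prop) ?_ ?_ ?_ ?_
  · refine (congrArg (HasSum · (cubicLaplace 0 z)) (funext fun n => ?_)).mp key
    rw [integral_const_mul, integral_complex_ofReal]
    have h := integral_rpow_mul_exp_neg_rpow (p := 3) (q := n) (by norm_num)
      (by linarith [n.cast_nonneg (α := ℝ)])
    norm_cast at h
    rw [h]
    push_cast
    ring
  · refine fun n => (ae_restrict_iff' measurableSet_Ioi).2 (.of_forall fun t ht => ?_)
    have ht : 0 < t := ht
    rw [norm_mul, norm_div, norm_pow, norm_neg, Complex.norm_real, Complex.norm_natCast,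
      Real.norm_of_nonneg (by positivity)]
    apply le_of_eq; ring
  · exact .of_forall fun t => (Real.summable_pow_div_factorial (‖z‖ * t)).mul_right _
  · have : (fun t : ℝ => ∑' n : ℕ, (‖z‖ * t) ^ n / n.factorial * Real.exp (-t ^ 3))
        = fun t => Real.exp (‖z‖ * t - t ^ 3) := by
      ext t
      rw [tsum_mul_right, ← congrFun NormedSpace.exp_eq_tsum_div, ← Real.exp_eq_exp_ℝ,
        ← Real.exp_add, sub_eq_add_neg]
    rw [this]
    exact integrableOn_exp_mul_sub_cube ‖z‖
  · refine .of_forall fun t => ?_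
    have h := (NormedSpace.expSeries_div_hasSum_exp (-z * (t : ℂ))).mul_right
      (Complex.exp (-(t : ℂ) ^ 3))
    rw [← Complex.exp_eq_exp_ℂ, ← Complex.exp_add] at h
    have h1 : ∀ n : ℕ, (-z * (t : ℂ)) ^ n / n.factorial * Complex.exp (-(t : ℂ) ^ 3)
        = (-z) ^ n / n.factorial * ((t ^ n * Real.exp (-t ^ 3) : ℝ) : ℂ) := fun n => by
      push_cast
      ring
    simp only [h1] at h
    rw [pow_zero, one_mul, sub_eq_neg_add, ← neg_mul]
    exact h

/-! ### The integral representation of the density -/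

/-- The primitive sixth root of unity `e^{iπ/3}`. -/
def sixthRoot : ℂ := Complex.exp ((Real.pi / 3 : ℝ) * Complex.I)

lemma sixthRoot_pow_im (n : ℕ) : (sixthRoot ^ n).im = Real.sin (n * (Real.pi / 3)) := by
  rw [sixthRoot, ← Complex.exp_nat_mul, ← mul_assoc, ← Complex.ofReal_natCast,
    ← Complex.ofReal_mul, Complex.exp_ofReal_mul_I_im]

lemma sixthRoot_pow_three : sixthRoot ^ 3 = -1 := by
  rw [sixthRoot, ← Complex.exp_nat_mul]
  rw [show ((3 : ℕ) : ℂ) * (((Real.pi / 3 : ℝ) : ℂ) * Complex.I) = Real.pi * Complex.I by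
    push_cast; ring]
  exact Complex.exp_pi_mul_I

lemma sixthRoot_re : sixthRoot.re = 1 / 2 := by
  rw [sixthRoot, Complex.exp_ofReal_mul_I_re, Real.cos_pi_div_three]

/-- The Maclaurin coefficients of the density, before grouping by residues modulo `3`. -/
def densityTerm (x : ℝ) (n : ℕ) : ℝ :=
  (-x) ^ n / n.factorial * (Real.Gamma ((n + 1) / 3) / Real.pi)
    * Real.sin ((n + 1 : ℕ) * (Real.pi / 3))

lemma hasSum_densityTerm (x : ℝ) :
    HasSum (densityTerm x) (3 / Real.pi * (sixthRoot * cubicLaplace 0 (x * sixthRoot)).im) := by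
  have h := (Complex.imCLM.hasSum ((hasSum_cubicLaplace_zero (x * sixthRoot)).mul_left
    sixthRoot)).mul_left (3 / Real.pi)
  refine (congrArg (HasSum · _) (funext fun n => ?_)).mp h
  have : sixthRoot * ((-(x * sixthRoot)) ^ n / n.factorial
      * (Real.Gamma ((n + 1) / 3) / 3 : ℝ))
      = (((-x) ^ n / n.factorial * (Real.Gamma ((n + 1) / 3) / 3) : ℝ) : ℂ)
        * sixthRoot ^ (n + 1) := by
    rw [← neg_mul, mul_pow]
    push_cast
    ring
  simp only [Complex.imCLM_apply]
  rw [this, Complex.im_ofReal_mul, sixthRoot_pow_im, densityTerm]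
  ring

/-- The sign of `(-x)³` cancels the sign change of the sine under a shift by `π`, and `Γ(s + 1) = s
Γ(s)` absorbs the factor `n + 1` of the factorial. This is the coefficient recursion of the Airy
series. -/
lemma densityTerm_add_three (x : ℝ) (n : ℕ) :
    densityTerm x (n + 3) = densityTerm x n * (x ^ 3 / 3 / ((n + 2) * (n + 3))) := by
  have h1 : ((n + 3 : ℕ) + 1 : ℝ) / 3 = (n + 1 : ℝ) / 3 + 1 := by push_cast; ring
  have h2 : Real.sin ((n + 3 + 1 : ℕ) * (Real.pi / 3)) = -Real.sin ((n + 1 : ℕ) * (Real.pi / 3)) := by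
    rw [← Real.sin_add_pi]
    congr 1
    push_cast
    ring
  have h3 : ((n + 3).factorial : ℝ) = (n + 3) * ((n + 2) * ((n + 1) * n.factorial)) := by
    rw [Nat.factorial_succ, Nat.factorial_succ, Nat.factorial_succ]
    push_cast
    ring
  rw [densityTerm, densityTerm, h1, h2, h3, Real.Gamma_add_one (by positivity)]
  field_simp
  ring

lemma Gamma_third_reflection :
    Real.Gamma (1 / 3) * Real.Gamma (2 / 3) = Real.pi / Real.sin (Real.pi / 3) := by
  have h := Real.Gamma_mul_Gamma_one_sub (1 / 3)
  rwa [show (1 : ℝ) - 1 / 3 = 2 / 3 by norm_num, mul_one_div] at h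

lemma three_rpow_third_pow_three : ((3 : ℝ) ^ (1 / 3 : ℝ)) ^ 3 = 3 := by
  rw [← Real.rpow_natCast, ← Real.rpow_mul (by norm_num)]
  norm_num

lemma three_rpow_two_thirds : (3 : ℝ) ^ (2 / 3 : ℝ) = ((3 : ℝ) ^ (1 / 3 : ℝ)) ^ 2 := by
  rw [← Real.rpow_natCast, ← Real.rpow_mul (by norm_num)]
  norm_num

lemma densityTerm_zero (x : ℝ) : densityTerm x 0 = 1 / Real.Gamma (2 / 3) := by
  have h := Gamma_third_reflection
  have hs : Real.sin (Real.pi / 3) ≠ 0 := by rw [Real.sin_pi_div_three]; positivity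
  have hG : Real.Gamma (2 / 3) ≠ 0 := (Real.Gamma_pos_of_pos (by norm_num)).ne'
  rw [eq_div_iff hs] at h
  simp only [densityTerm]
  rw [show ((0 : ℕ) + 1 : ℝ) / 3 = 1 / 3 by norm_num, show ((0 + 1 : ℕ) : ℝ) = 1 by norm_num,
    one_mul, eq_div_iff hG]
  simp only [pow_zero, Nat.factorial_zero, Nat.cast_one, div_one, one_mul]
  have := Real.pi_ne_zero
  field_simp
  linear_combination h

lemma densityTerm_one (x : ℝ) : densityTerm x 1 = -x / Real.Gamma (1 / 3) := by
  have h := Gamma_third_reflection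
  have hs : Real.sin (Real.pi / 3) ≠ 0 := by rw [Real.sin_pi_div_three]; positivity
  have hG : Real.Gamma (1 / 3) ≠ 0 := (Real.Gamma_pos_of_pos (by norm_num)).ne'
  have h2 : Real.sin (2 * (Real.pi / 3)) = Real.sin (Real.pi / 3) := by
    rw [← Real.sin_pi_sub]; congr 1; ring
  rw [eq_div_iff hs] at h
  simp only [densityTerm]
  rw [show ((1 : ℕ) + 1 : ℝ) / 3 = 2 / 3 by norm_num, show ((1 + 1 : ℕ) : ℝ) = 2 by norm_num, h2,
    eq_div_iff hG]
  simp only [pow_one, Nat.factorial_one, Nat.cast_one, div_one]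
  have := Real.pi_ne_zero
  field_simp
  linear_combination -x * h

lemma densityTerm_two (x : ℝ) : densityTerm x 2 = 0 := by
  have : Real.sin ((2 + 1 : ℕ) * (Real.pi / 3)) = 0 := by
    rw [show ((2 + 1 : ℕ) : ℝ) * (Real.pi / 3) = Real.pi by push_cast; ring, Real.sin_pi]
  rw [densityTerm, this, mul_zero]

lemma densityTerm_three_mul (x : ℝ) (k : ℕ) :
    densityTerm x (0 + 3 * k) = 1 / Real.Gamma (2 / 3) * ((x / (3 : ℝ) ^ (1 / 3 : ℝ)) ^ (3 * k)
      / ∏ j ∈ Finset.range k, ((3 * (j : ℝ) + 2) * (3 * (j : ℝ) + 3))) := by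
  induction k with
  | zero => simp [densityTerm_zero]
  | succ k ih =>
    rw [show 0 + 3 * (k + 1) = (0 + 3 * k) + 3 by ring, densityTerm_add_three, ih,
      Finset.prod_range_succ, show 3 * (k + 1) = 3 * k + 3 by ring, pow_add _ (3 * k) 3,
      div_pow x _ 3, three_rpow_third_pow_three]
    push_cast
    rw [zero_add, mul_div_mul_comm, mul_assoc]

lemma densityTerm_three_mul_add_one (x : ℝ) (k : ℕ) :
    densityTerm x (1 + 3 * k) = -((3 : ℝ) ^ (1 / 3 : ℝ) / Real.Gamma (1 / 3))
      * ((x / (3 : ℝ) ^ (1 / 3 : ℝ)) ^ (3 * k + 1)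
        / ∏ j ∈ Finset.range k, ((3 * (j : ℝ) + 3) * (3 * (j : ℝ) + 4))) := by
  induction k with
  | zero =>
    have : (3 : ℝ) ^ (1 / 3 : ℝ) ≠ 0 := by positivity
    simp only [mul_zero, add_zero, densityTerm_one, Finset.prod_range_zero, zero_add, pow_one]
    field_simp
  | succ k ih =>
    rw [show 1 + 3 * (k + 1) = (1 + 3 * k) + 3 by ring, densityTerm_add_three, ih,
      Finset.prod_range_succ, show 3 * (k + 1) + 1 = (3 * k + 1) + 3 by ring, pow_add _ (3 * k + 1) 3,
      div_pow x _ 3, three_rpow_third_pow_three]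
    push_cast
    rw [mul_div_mul_comm, mul_assoc]
    ring

lemma densityTerm_three_mul_add_two (x : ℝ) (k : ℕ) : densityTerm x (2 + 3 * k) = 0 := by
  induction k with
  | zero => exact densityTerm_two x
  | succ k ih => rw [show 2 + 3 * (k + 1) = (2 + 3 * k) + 3 by ring, densityTerm_add_three, ih,
      zero_mul]

/-- The integral representation
`M_{1/3}(x) = (3 / π) Im (ω ∫₀^∞ e^{-t³ - ω x t} dt)`, `ω = e^{iπ/3}`. -/
theorem density_eq_cubicLaplace (x : ℝ) :
    density x = 3 / Real.pi * (sixthRoot * cubicLaplace 0 (x * sixthRoot)).im := by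
  have h := hasSum_densityTerm x
  -- Residues `0` and `1` modulo `3` give the two Airy series; residue `2` vanishes because `sin π =
  -- 0`.
  rw [← h.tsum_eq, Nat.sumByResidueClasses h.summable 3]
  have hsum : ∀ g : ZMod 3 → ℝ, ∑ j, g j = g 0 + g 1 + g 2 := fun g => Fin.sum_univ_three g
  have hv : (0 : ZMod 3).val = 0 ∧ (1 : ZMod 3).val = 1 ∧ (2 : ZMod 3).val = 2 := by decide
  rw [hsum, hv.1, hv.2.1, hv.2.2]
  simp only [densityTerm_three_mul, densityTerm_three_mul_add_one, densityTerm_three_mul_add_two]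
  rw [tsum_mul_left, tsum_mul_left, tsum_zero, density, Ai, airySeries₀, airySeries₁,
    three_rpow_two_thirds]
  have hc : (3 : ℝ) ^ (1 / 3 : ℝ) ≠ 0 := by positivity
  have hG1 : Real.Gamma (1 / 3) ≠ 0 := (Real.Gamma_pos_of_pos (by norm_num)).ne'
  have hG2 : Real.Gamma (2 / 3) ≠ 0 := (Real.Gamma_pos_of_pos (by norm_num)).ne'
  generalize (∑' k : ℕ, _ : ℝ) = A
  generalize (∑' k : ℕ, _ : ℝ) = B
  generalize (3 : ℝ) ^ (1 / 3 : ℝ) = c at *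
  field_simp
  ring

/-! ### The Airy equation, initial values and decay -/

/-- The derivative of the density. -/
def densityDeriv (x : ℝ) : ℝ :=
  -(3 / Real.pi * (sixthRoot ^ 2 * cubicLaplace 1 (x * sixthRoot)).im)

lemma _root_.HasDerivAt.im_comp_ofReal {f : ℂ → ℂ} {f' : ℂ} {x : ℝ} (h : HasDerivAt f f' x) :
    HasDerivAt (fun t : ℝ => (f t).im) f'.im x :=
  Complex.imCLM.hasFDerivAt.comp_hasDerivAt x h.comp_ofReal

lemma hasDerivAt_im_mul_cubicLaplace (n : ℕ) (c : ℂ) (x : ℝ) :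
    HasDerivAt (fun x : ℝ => (c * cubicLaplace n (x * sixthRoot)).im)
      (-(c * sixthRoot * cubicLaplace (n + 1) (x * sixthRoot)).im) x := by
  have h := (hasDerivAt_cubicLaplace n (x * sixthRoot)).comp (x : ℂ)
    ((hasDerivAt_id' (x : ℂ)).mul_const sixthRoot)
  refine (h.const_mul c).im_comp_ofReal.congr_deriv ?_
  rw [← Complex.neg_im]
  congr 1
  ring

lemma hasDerivAt_density (x : ℝ) : HasDerivAt density (densityDeriv x) x := by
  rw [show density = _ from funext density_eq_cubicLaplace]
  refine ((hasDerivAt_im_mul_cubicLaplace 0 sixthRoot x).const_mul (3 / Real.pi)).congr_deriv ?_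
  rw [densityDeriv, sq]
  ring

/-- The Airy equation `M'' = x M / 3` for the density. -/
lemma hasDerivAt_densityDeriv (x : ℝ) :
    HasDerivAt densityDeriv (1 / 3 * x * density x) x := by
  refine ((hasDerivAt_im_mul_cubicLaplace 1 (sixthRoot ^ 2) x).const_mul
    (3 / Real.pi)).fun_neg.congr_deriv ?_
  -- The inhomogeneous term `1` is real, so it disappears from the imaginary part.
  have h := congrArg Complex.im (three_mul_cubicLaplace_two_add (x * sixthRoot))
  have h1 : x * sixthRoot * cubicLaplace 0 (x * sixthRoot)
      = x * (sixthRoot * cubicLaplace 0 (x * sixthRoot)) := by ring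
  have h3 : (3 : ℂ) * cubicLaplace 2 (x * sixthRoot)
      = ((3 : ℝ) : ℂ) * cubicLaplace 2 (x * sixthRoot) := by norm_num
  rw [h1, h3, Complex.add_im, Complex.im_ofReal_mul, Complex.im_ofReal_mul, Complex.one_im] at h
  rw [← pow_succ, sixthRoot_pow_three, density_eq_cubicLaplace, neg_one_mul, Complex.neg_im]
  linear_combination (-1 / Real.pi) * h

lemma cubicLaplace_apply_zero (n : ℕ) :
    cubicLaplace n 0 = (Real.Gamma ((n + 1) / 3) / 3 : ℝ) := by
  have h := integral_rpow_mul_exp_neg_rpow (p := 3) (q := n) (by norm_num)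
    (by linarith [n.cast_nonneg (α := ℝ)])
  norm_cast at h
  rw [show Real.Gamma ((n + 1) / 3) / 3 = 1 / 3 * Real.Gamma (↑(n + 1) / 3) by
    push_cast; ring, ← h, ← integral_complex_ofReal, cubicLaplace]
  congr 1
  ext t
  push_cast
  simp

lemma density_zero : density 0 = 1 / Real.Gamma (2 / 3) := by
  rw [← densityTerm_zero 0, density_eq_cubicLaplace, densityTerm, Complex.ofReal_zero, zero_mul,
    cubicLaplace_apply_zero, Complex.im_mul_ofReal, ← pow_one sixthRoot, sixthRoot_pow_im]
  simp
  ring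

lemma densityDeriv_zero : densityDeriv 0 = -(1 / Real.Gamma (1 / 3)) := by
  have h := densityTerm_one 1
  rw [neg_div] at h
  rw [← h, densityDeriv, densityTerm, Complex.ofReal_zero, zero_mul,
    cubicLaplace_apply_zero, Complex.im_mul_ofReal, sixthRoot_pow_im]
  norm_num
  ring

lemma density_zero_pos : 0 < density 0 := by
  rw [density_zero]
  exact one_div_pos.2 (Real.Gamma_pos_of_pos (by norm_num))

lemma tendsto_cubicLaplace_mul_sixthRoot (n : ℕ) :
    Tendsto (fun x : ℝ => cubicLaplace n (x * sixthRoot)) atTop (𝓝 0) := by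
  have hb : Tendsto (fun x : ℝ => n.factorial / (x / 2) ^ (n + 1)) atTop (𝓝 0) :=
    Tendsto.const_div_atTop ((tendsto_pow_atTop n.succ_ne_zero).comp
      (tendsto_id.atTop_div_const two_pos)) _
  refine squeeze_zero_norm' ?_ hb
  filter_upwards [eventually_gt_atTop 0] with x hx
  have hre : ((x : ℂ) * sixthRoot).re = x / 2 := by
    rw [Complex.re_ofReal_mul, sixthRoot_re]; ring
  rw [← hre]
  exact norm_cubicLaplace_le n (by rw [hre]; positivity)

lemma tendsto_im_mul_cubicLaplace (n : ℕ) (c : ℂ) :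
    Tendsto (fun x : ℝ => (c * cubicLaplace n (x * sixthRoot)).im) atTop (𝓝 0) := by
  have := (Complex.continuous_im.tendsto _).comp
    ((tendsto_cubicLaplace_mul_sixthRoot n).const_mul c)
  simpa [Function.comp_def] using this

lemma tendsto_density : Tendsto density atTop (𝓝 0) := by
  rw [show density = _ from funext density_eq_cubicLaplace]
  simpa using (tendsto_im_mul_cubicLaplace 0 sixthRoot).const_mul (3 / Real.pi)

lemma tendsto_densityDeriv : Tendsto densityDeriv atTop (𝓝 0) := by
  have h := ((tendsto_im_mul_cubicLaplace 1 (sixthRoot ^ 2)).const_mul (3 / Real.pi)).neg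
  rwa [mul_zero, neg_zero] at h

@[fun_prop]
lemma continuous_density : Continuous density :=
  continuous_iff_continuousAt.2 fun x => (hasDerivAt_density x).continuousAt

@[fun_prop]
lemma continuous_densityDeriv : Continuous densityDeriv :=
  continuous_iff_continuousAt.2 fun x => (hasDerivAt_densityDeriv x).continuousAt

/-! ### Positivity of the density -/

lemma hasDerivAt_density_mul_deriv (x : ℝ) :
    HasDerivAt (fun x => density x * densityDeriv x)
      (densityDeriv x ^ 2 + 1 / 3 * x * density x ^ 2) x :=
  ((hasDerivAt_density x).fun_mul (hasDerivAt_densityDeriv x)).congr_deriv (by ring)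

lemma monotoneOn_density_mul_deriv :
    MonotoneOn (fun x => density x * densityDeriv x) (Ici 0) := by
  refine monotoneOn_of_deriv_nonneg (convex_Ici 0) (by fun_prop)
    (fun x _ => (hasDerivAt_density_mul_deriv x).differentiableAt.differentiableWithinAt) ?_
  intro x hx
  rw [interior_Ici] at hx
  have hx : 0 < x := hx
  rw [(hasDerivAt_density_mul_deriv x).deriv]
  positivity

/-- A nondecreasing function with limit `0` at infinity is nonpositive. -/
lemma density_mul_deriv_nonpos {x : ℝ} (hx : 0 ≤ x) : density x * densityDeriv x ≤ 0 := by
  have h : Tendsto (fun x => density x * densityDeriv x) atTop (𝓝 0) := by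
    simpa using tendsto_density.mul tendsto_densityDeriv
  refine ge_of_tendsto h ?_
  filter_upwards [eventually_ge_atTop x] with y hy
  exact monotoneOn_density_mul_deriv hx (hx.trans hy) hy

/-- A Grönwall argument. On `[0, b]` the weight `e^{(1+b)x}` makes `E` nondecreasing, since `2 M M'
≥ -(M² + M'²)` and `1 + x/3 ≤ 1 + b`. As `E 0 > 0`, `M` and `M'` cannot both vanish at `b`. -/
lemma density_or_deriv_ne_zero {b : ℝ} (hb : 0 ≤ b) : density b ≠ 0 ∨ densityDeriv b ≠ 0 := by
  by_contra! h
  set E : ℝ → ℝ := fun x => Real.exp ((1 + b) * x) * (density x ^ 2 + densityDeriv x ^ 2) with hE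
  have hder : ∀ x, HasDerivAt E (Real.exp ((1 + b) * x) * ((1 + b) * (density x ^ 2
      + densityDeriv x ^ 2) + 2 * (1 + x / 3) * (density x * densityDeriv x))) x := by
    intro x
    have h1 : HasDerivAt (fun x => Real.exp ((1 + b) * x))
        (Real.exp ((1 + b) * x) * ((1 + b) * 1)) x :=
      ((hasDerivAt_id' x).const_mul (1 + b)).exp
    refine (h1.fun_mul (((hasDerivAt_density x).fun_pow 2).fun_add
      ((hasDerivAt_densityDeriv x).fun_pow 2))).congr_deriv ?_
    norm_num
    ring
  have hmono : MonotoneOn E (Icc 0 b) := by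
    refine monotoneOn_of_deriv_nonneg (convex_Icc 0 b)
      (fun x _ => (hder x).continuousAt.continuousWithinAt)
      (fun x _ => (hder x).differentiableAt.differentiableWithinAt) fun x hx => ?_
    rw [interior_Icc] at hx
    rw [(hder x).deriv]
    refine mul_nonneg (Real.exp_pos _).le ?_
    have h0 : 0 ≤ 1 + x / 3 := by linarith [hx.1]
    nlinarith [mul_nonneg h0 (sq_nonneg (density x + densityDeriv x)),
      mul_nonneg (by linarith [hx.1, hx.2] : 0 ≤ b - x / 3)
        (add_nonneg (sq_nonneg (density x)) (sq_nonneg (densityDeriv x)))]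
  have h0 := hmono (left_mem_Icc.2 hb) (right_mem_Icc.2 hb) hb
  simp only [hE, h.1, h.2, mul_zero, Real.exp_zero, one_mul] at h0
  nlinarith [pow_pos density_zero_pos 2, sq_nonneg (densityDeriv 0)]

/-- If `M a = 0`, then `M M'` is nondecreasing from `0` and nonpositive, hence zero on `[a, ∞)`. Its
derivative `M'² + x M² / 3` then vanishes at `a + 1`, a point that is positive even when `a = 0`, so
`M` and `M'` both vanish there. -/
lemma density_ne_zero {a : ℝ} (ha : 0 ≤ a) : density a ≠ 0 := by
  intro h
  have hzero : ∀ x, a ≤ x → density x * densityDeriv x = 0 := fun x hx =>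
    le_antisymm (density_mul_deriv_nonpos (ha.trans hx)) (by
      simpa [h] using monotoneOn_density_mul_deriv ha (ha.trans hx) hx)
  have hev : (fun x => density x * densityDeriv x) =ᶠ[𝓝 (a + 1)] fun _ => 0 := by
    filter_upwards [lt_mem_nhds (lt_add_one a)] with x hx using hzero x hx.le
  have hd := (hasDerivAt_density_mul_deriv (a + 1)).unique
    ((hasDerivAt_const (a + 1) (0 : ℝ)).congr_of_eventuallyEq hev)
  have h1 : 0 ≤ densityDeriv (a + 1) ^ 2 := sq_nonneg _
  have h2 : 0 ≤ 1 / 3 * (a + 1) * density (a + 1) ^ 2 := by positivity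
  rcases density_or_deriv_ne_zero (b := a + 1) (by positivity) with h' | h'
  · have : 0 < 1 / 3 * (a + 1) * density (a + 1) ^ 2 := by positivity
    linarith
  · have : 0 < densityDeriv (a + 1) ^ 2 := by positivity
    linarith

lemma density_pos {x : ℝ} (hx : 0 ≤ x) : 0 < density x := by
  by_contra! h
  obtain ⟨c, hc, hc0⟩ := intermediate_value_Icc' hx continuous_density.continuousOn
    ⟨h, density_zero_pos.le⟩
  exact density_ne_zero hc.1 hc0

/-! ### Total mass and first moment of the density -/

lemma im_cubicLaplace_ofReal (n : ℕ) (x : ℝ) : (cubicLaplace n x).im = 0 := by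
  have : cubicLaplace n x
      = ((∫ t in Ioi (0 : ℝ), t ^ n * Real.exp (-t ^ 3 - x * t) : ℝ) : ℂ) := by
    rw [← integral_complex_ofReal, cubicLaplace]
    push_cast
    rfl
  rw [this, Complex.ofReal_im]

/-- Along the ray of argument `π/3`, the imaginary part of a primitive of `cubicLaplace 0` tends
to `π/3`, by comparison with the positive real axis, where it vanishes. -/
lemma tendsto_im_primitive {F : ℂ → ℂ} (hF : ∀ z, HasDerivAt F (cubicLaplace 0 z) z)
    (hF0 : F 0 = 0) :
    Tendsto (fun x : ℝ => (F (x * sixthRoot)).im) atTop (𝓝 (Real.pi / 3)) := by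
  have hreal : ∀ x : ℝ, (F x).im = 0 := by
    have hd : ∀ x : ℝ, HasDerivAt (fun x : ℝ => (F x).im) 0 x := fun x =>
      (hF x).im_comp_ofReal.congr_deriv (im_cubicLaplace_ofReal 0 x)
    intro x
    have := is_const_of_deriv_eq_zero (fun x => (hd x).differentiableAt) (fun x => (hd x).deriv) x 0
    simpa [hF0] using this
  have hbound : ∀ x : ℝ, 0 < x →
      |(F (x * sixthRoot)).im - Real.pi / 3| ≤ 3 * (2 / (x / 2) ^ 3) * (Real.pi / 3) := by
    intro x hx
    -- Along the arc of radius `x`, `dF/dθ = i z L(z)` with `z L(z) = 1 - 3 L''(z)`. After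
    -- subtracting `iθ` the derivative is `-3 i L''(z)`, of order `x⁻³` because `Re z ≥ x / 2` in
    -- the sector.
    set φ : ℝ → ℂ := fun θ => F (x * Complex.exp (θ * Complex.I)) - θ * Complex.I with hφ
    have hder : ∀ θ : ℝ, HasDerivAt φ (Complex.I *
        (x * Complex.exp (θ * Complex.I) * cubicLaplace 0 (x * Complex.exp (θ * Complex.I)) - 1))
        θ := by
      intro θ
      have h1 : HasDerivAt (fun θ : ℂ => θ * Complex.I) (1 * Complex.I) (θ : ℂ) :=
        (hasDerivAt_id' (θ : ℂ)).mul_const _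
      have h2 := ((hF (x * Complex.exp (θ * Complex.I))).comp (θ : ℂ)
        (h1.cexp.const_mul (x : ℂ))).fun_sub h1
      refine h2.comp_ofReal.congr_deriv ?_
      ring
    have hle : ∀ θ ∈ Ico (0 : ℝ) (Real.pi / 3), ‖Complex.I *
        (x * Complex.exp (θ * Complex.I) * cubicLaplace 0 (x * Complex.exp (θ * Complex.I)) - 1)‖
        ≤ 3 * (2 / (x / 2) ^ 3) := by
      intro θ hθ
      set z : ℂ := x * Complex.exp (θ * Complex.I) with hz
      have hre : x / 2 ≤ z.re := by
        rw [hz, Complex.re_ofReal_mul, Complex.exp_ofReal_mul_I_re]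
        have : Real.cos (Real.pi / 3) ≤ Real.cos θ :=
          Real.cos_le_cos_of_nonneg_of_le_pi hθ.1 (by linarith [Real.pi_pos]) hθ.2.le
        rw [Real.cos_pi_div_three] at this
        nlinarith
      have hz0 : 0 < z.re := by linarith
      have h3 : z * cubicLaplace 0 z - 1 = -(3 * cubicLaplace 2 z) := by
        linear_combination three_mul_cubicLaplace_two_add z
      rw [h3, norm_mul, Complex.norm_I, one_mul, norm_neg, norm_mul, Complex.norm_ofNat]
      have h4 := norm_cubicLaplace_le 2 hz0
      have h5 : ((Nat.factorial 2 : ℕ) : ℝ) / z.re ^ (2 + 1) ≤ 2 / (x / 2) ^ 3 := by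
        norm_num only [Nat.factorial]
        gcongr
      gcongr
      exact h4.trans h5
    have hmv := norm_image_sub_le_of_norm_deriv_le_segment'
      (fun θ _ => (hder θ).hasDerivWithinAt) hle (Real.pi / 3)
      (right_mem_Icc.2 (by positivity))
    rw [sub_zero] at hmv
    refine le_trans ?_ hmv
    refine le_trans (le_of_eq ?_) (Complex.abs_im_le_norm _)
    have e1 : φ (Real.pi / 3) = F (x * sixthRoot) - (Real.pi / 3 : ℝ) * Complex.I := rfl
    have e0 : φ 0 = F x := by simp [hφ]
    rw [e1, e0]
    simp [hreal]
  have hb : Tendsto (fun x : ℝ => 3 * (2 / (x / 2) ^ 3) * (Real.pi / 3)) atTop (𝓝 0) := by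
    have : Tendsto (fun x : ℝ => 2 / (x / 2) ^ 3) atTop (𝓝 0) :=
      Tendsto.const_div_atTop ((tendsto_pow_atTop three_ne_zero).comp
        (tendsto_id.atTop_div_const two_pos)) _
    simpa using (this.const_mul 3).mul_const (Real.pi / 3)
  rw [tendsto_iff_norm_sub_tendsto_zero]
  refine squeeze_zero' (.of_forall fun _ => norm_nonneg _) ?_ hb
  filter_upwards [eventually_gt_atTop 0] with x hx using hbound x hx

lemma exists_hasDerivAt_density :
    ∃ g : ℝ → ℝ, g 0 = 0 ∧ (∀ x, HasDerivAt g (density x) x) ∧ Tendsto g atTop (𝓝 1) := by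
  have hdiff : Differentiable ℂ (cubicLaplace 0) := fun z =>
    (hasDerivAt_cubicLaplace 0 z).differentiableAt
  obtain ⟨F, hF0, hF⟩ := hdiff.isExactOn_univ.with_val_at 0 0
  refine ⟨fun x => 3 / Real.pi * (F (x * sixthRoot)).im, by simp [hF0], fun x => ?_, ?_⟩
  · have h := ((hF (x * sixthRoot) (mem_univ _)).comp (x : ℂ)
      ((hasDerivAt_id' (x : ℂ)).mul_const sixthRoot)).im_comp_ofReal.const_mul (3 / Real.pi)
    refine h.congr_deriv ?_
    rw [density_eq_cubicLaplace, one_mul, mul_comm sixthRoot]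
  · have h := (tendsto_im_primitive (fun z => hF z (mem_univ z)) hF0).const_mul (3 / Real.pi)
    have : 3 / Real.pi * (Real.pi / 3) = 1 := by field_simp
    rwa [this] at h

lemma integrableOn_density : IntegrableOn density (Ioi 0) := by
  obtain ⟨g, -, hg, hlim⟩ := exists_hasDerivAt_density
  exact integrableOn_Ioi_deriv_of_nonneg' (fun x _ => hg x)
    (fun x hx => (density_pos (le_of_lt hx)).le) hlim

/-- The density has total mass one. -/
theorem integral_density : ∫ x in Ioi (0 : ℝ), density x = 1 := by
  obtain ⟨g, hg0, hg, hlim⟩ := exists_hasDerivAt_density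
  rw [integral_Ioi_of_hasDerivAt_of_nonneg' (fun x _ => hg x)
    (fun x hx => (density_pos (le_of_lt hx)).le) hlim, hg0, sub_zero]

/-- The integrand is the derivative of `M'`, is nonnegative, and `M'` has a limit at infinity. -/
lemma integrableOn_mul_density : IntegrableOn (fun x => 1 / 3 * x * density x) (Ioi 0) :=
  integrableOn_Ioi_deriv_of_nonneg' (fun x _ => hasDerivAt_densityDeriv x)
    (fun x hx => by
      have hx : 0 < x := hx
      have := density_pos hx.le
      positivity) tendsto_densityDeriv

/-! ### The law, and mean zero of the Stein operator -/

lemma law_eq : law = (volume.restrict (Ioi 0)).withDensity fun x => ENNReal.ofReal (density x) := by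
  rw [law, Measure.restrict_congr_set Ioi_ae_eq_Ici]

lemma toReal_ofReal_density_ae :
    ∀ᵐ x ∂volume.restrict (Ioi (0 : ℝ)), (ENNReal.ofReal (density x)).toReal = density x :=
  (ae_restrict_iff' measurableSet_Ioi).2
    (.of_forall fun _ hx => ENNReal.toReal_ofReal (density_pos (le_of_lt hx)).le)

lemma integral_law (g : ℝ → ℝ) : ∫ x, g x ∂law = ∫ x in Ioi (0 : ℝ), g x * density x := by
  rw [law_eq, integral_withDensity_eq_integral_toReal_smul (by fun_prop)
    (.of_forall fun _ => ENNReal.ofReal_lt_top)]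
  refine integral_congr_ae ?_
  filter_upwards [toReal_ofReal_density_ae] with x hx
  rw [hx, smul_eq_mul, mul_comm]

lemma integrable_law_iff (g : ℝ → ℝ) :
    Integrable g law ↔ IntegrableOn (fun x => g x * density x) (Ioi 0) := by
  rw [law_eq, integrable_withDensity_iff (by fun_prop) (.of_forall fun _ => ENNReal.ofReal_lt_top)]
  refine integrable_congr ?_
  filter_upwards [toReal_ofReal_density_ae] with x hx
  rw [hx]

instance isProbabilityMeasure_law : IsProbabilityMeasure law := by
  refine ⟨?_⟩
  rw [law_eq, withDensity_apply _ MeasurableSet.univ, Measure.restrict_univ,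
    ← ofReal_integral_eq_lintegral_ofReal integrableOn_density, integral_density, ENNReal.ofReal_one]
  exact (ae_restrict_iff' measurableSet_Ioi).2 (.of_forall fun _ hx => (density_pos (le_of_lt hx)).le)

lemma integrable_steinOp_law {f : ℝ → ℝ} (hf : IsCb2 f) : Integrable (steinOp f) law := by
  obtain ⟨hf, C, hC⟩ := hf
  have hs : UniqueDiffOn ℝ (Ici (0 : ℝ)) := uniqueDiffOn_Ici 0
  have hc0 : ContinuousOn f (Ioi 0) := hf.continuousOn.mono Ioi_subset_Ici_self
  have hc2 : ContinuousOn (iteratedDerivWithin 2 f (Ici 0)) (Ioi 0) :=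
    (hf.continuousOn_iteratedDerivWithin le_rfl hs).mono Ioi_subset_Ici_self
  rw [integrable_law_iff]
  have h2 : IntegrableOn (fun x => iteratedDerivWithin 2 f (Ici 0) x * density x) (Ioi 0) :=
    integrableOn_density.bdd_mul (c := C) (hc2.aestronglyMeasurable measurableSet_Ioi)
      ((ae_restrict_iff' measurableSet_Ioi).2 (.of_forall fun x hx => (hC x (Ioi_subset_Ici_self hx)).2.2))
  have h0 : IntegrableOn (fun x => f x * (1 / 3 * x * density x)) (Ioi 0) :=
    integrableOn_mul_density.bdd_mul (c := C) (hc0.aestronglyMeasurable measurableSet_Ioi)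
      ((ae_restrict_iff' measurableSet_Ioi).2 (.of_forall fun x hx => (hC x (Ioi_subset_Ici_self hx)).1))
  refine (h2.sub h0).congr_fun (fun x _ => ?_) measurableSet_Ioi
  simp only [steinOp, Pi.sub_apply]
  ring

/-- Integration by parts: the Stein operator has mean zero under the `M`-Wright law. -/
theorem integral_steinOp_law {f : ℝ → ℝ} (hf : f ∈ steinDomain) : ∫ x, steinOp f x ∂law = 0 := by
  obtain ⟨hCb, hbc⟩ := hf
  have hint := (integrable_law_iff _).1 (integrable_steinOp_law hCb)
  obtain ⟨hf, C, hC⟩ := hCb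
  have hs : UniqueDiffOn ℝ (Ici (0 : ℝ)) := uniqueDiffOn_Ici 0
  have hf' : ContDiffOn ℝ 1 (derivWithin f (Ici 0)) (Ici 0) :=
    hf.derivWithin hs (by norm_num)
  have hd0 : ∀ x ∈ Ioi (0 : ℝ), HasDerivAt f (derivWithin f (Ici 0) x) x := fun x hx =>
    ((hf.differentiableOn (by norm_num) x (Ioi_subset_Ici_self hx)).hasDerivWithinAt).hasDerivAt
      (Ici_mem_nhds hx)
  have hd1 : ∀ x ∈ Ioi (0 : ℝ), HasDerivAt (derivWithin f (Ici 0))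
      (iteratedDerivWithin 2 f (Ici 0) x) x := fun x hx => by
    have h := ((hf'.differentiableOn (by norm_num) x (Ioi_subset_Ici_self hx)).hasDerivWithinAt).hasDerivAt
      (Ici_mem_nhds hx)
    rwa [iteratedDerivWithin_succ, iteratedDerivWithin_one]
  -- The boundary form: its derivative is `(A f) M`, because the terms `f' M'` cancel and `M'' = x M
  -- / 3`.
  set B : ℝ → ℝ := fun x => derivWithin f (Ici 0) x * density x - f x * densityDeriv x with hB
  have hcont : ContinuousWithinAt B (Ici 0) 0 :=
    ((hf'.continuousOn 0 self_mem_Ici).mul continuous_density.continuousWithinAt).sub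
      ((hf.continuousOn 0 self_mem_Ici).mul continuous_densityDeriv.continuousWithinAt)
  have hder : ∀ x ∈ Ioi (0 : ℝ), HasDerivAt B (steinOp f x * density x) x := fun x hx => by
    refine (((hd1 x hx).fun_mul (hasDerivAt_density x)).fun_sub
      ((hd0 x hx).fun_mul (hasDerivAt_densityDeriv x))).congr_deriv ?_
    rw [steinOp]
    ring
  have hlim : Tendsto B atTop (𝓝 0) := by
    have hb : ∀ {u v : ℝ → ℝ}, (∀ x ∈ Ici (0 : ℝ), |u x| ≤ C) → Tendsto v atTop (𝓝 0) →
        Tendsto (fun x => u x * v x) atTop (𝓝 0) := fun {u v} hu hv => by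
      refine squeeze_zero_norm' ?_ (by simpa using hv.norm.const_mul C)
      filter_upwards [eventually_ge_atTop 0] with x hx
      rw [norm_mul]
      exact mul_le_mul_of_nonneg_right (hu x hx) (norm_nonneg _)
    simpa using (hb (fun x hx => (hC x hx).2.1) tendsto_density).sub
      (hb (fun x hx => (hC x hx).1) tendsto_densityDeriv)
  rw [integral_law, integral_Ioi_of_hasDerivAt_of_tendsto hcont hder hint hlim, hB]
  simp only [density_zero, densityDeriv_zero]
  linear_combination -hbc

/-! ### Solving the Stein equation -/

/-- Boundedness comes from compactness of `[0, R]` and vanishing beyond `R`. -/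
lemma isCb2_of_hasDerivWithinAt {f f₁ f₂ : ℝ → ℝ} {R : ℝ}
    (h₁ : ∀ x ∈ Ici (0 : ℝ), HasDerivWithinAt f (f₁ x) (Ici 0) x)
    (h₂ : ∀ x ∈ Ici (0 : ℝ), HasDerivWithinAt f₁ (f₂ x) (Ici 0) x)
    (hc : ContinuousOn f₂ (Ici 0)) (hR : ∀ x, R ≤ x → f x = 0 ∧ f₁ x = 0 ∧ f₂ x = 0) :
    IsCb2 f ∧ derivWithin f (Ici 0) 0 = f₁ 0 ∧
      ∀ x ∈ Ici (0 : ℝ), iteratedDerivWithin 2 f (Ici 0) x = f₂ x := by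
  have hs : UniqueDiffOn ℝ (Ici (0 : ℝ)) := uniqueDiffOn_Ici 0
  have e₁ : ∀ x ∈ Ici (0 : ℝ), derivWithin f (Ici 0) x = f₁ x := fun x hx =>
    (h₁ x hx).derivWithin (hs x hx)
  have e₂ : ∀ x ∈ Ici (0 : ℝ), iteratedDerivWithin 2 f (Ici 0) x = f₂ x := fun x hx => by
    rw [iteratedDerivWithin_succ, iteratedDerivWithin_one, derivWithin_congr e₁ (e₁ x hx), (h₂ x hx).derivWithin (hs x hx)]
  have hcd₁ : ContDiffOn ℝ 1 f₁ (Ici 0) := by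
    rw [show (1 : WithTop ℕ∞) = 0 + 1 from rfl, contDiffOn_succ_iff_derivWithin hs]
    refine ⟨fun x hx => (h₂ x hx).differentiableWithinAt, by simp, contDiffOn_zero.2 ?_⟩
    exact hc.congr fun x hx => (h₂ x hx).derivWithin (hs x hx)
  have hcd : ContDiffOn ℝ 2 f (Ici 0) := by
    rw [show (2 : WithTop ℕ∞) = 1 + 1 from rfl, contDiffOn_succ_iff_derivWithin hs]
    exact ⟨fun x hx => (h₁ x hx).differentiableWithinAt, by simp, hcd₁.congr e₁⟩
  have hbdd : ∀ g : ℝ → ℝ, ContinuousOn g (Ici 0) → (∀ x, R ≤ x → g x = 0) →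
      ∃ C, 0 ≤ C ∧ ∀ x ∈ Ici (0 : ℝ), |g x| ≤ C := fun g hg hgR => by
    obtain ⟨C, hC⟩ := (isCompact_Icc (a := (0 : ℝ)) (b := R)).exists_bound_of_continuousOn
      (hg.mono Icc_subset_Ici_self)
    refine ⟨max C 0, le_max_right _ _, fun x hx => ?_⟩
    rcases le_total x R with h | h
    · exact (hC x ⟨hx, h⟩).trans (le_max_left _ _)
    · rw [hgR x h, abs_zero]
      exact le_max_right _ _
  obtain ⟨C₀, hC₀, hb₀⟩ := hbdd f hcd.continuousOn fun x hx => (hR x hx).1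
  obtain ⟨C₁, hC₁, hb₁⟩ := hbdd f₁ hcd₁.continuousOn fun x hx => (hR x hx).2.1
  obtain ⟨C₂, hC₂, hb₂⟩ := hbdd f₂ hc fun x hx => (hR x hx).2.2
  refine ⟨⟨hcd, C₀ + C₁ + C₂, fun x hx => ?_⟩, e₁ 0 self_mem_Ici, e₂⟩
  rw [e₁ x hx, e₂ x hx]
  exact ⟨by linarith [hb₀ x hx], by linarith [hb₁ x hx], by linarith [hb₂ x hx]⟩

/-- The Stein equation `A f = h` has a compactly supported solution in the Stein domain
whenever `h` is continuous, vanishes near infinity, and has mean zero under the law. -/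
theorem exists_steinOp_eq {h : ℝ → ℝ} (hh : Continuous h) {R : ℝ} (hR0 : 0 ≤ R)
    (hR : ∀ x, R ≤ x → h x = 0) (hmean : ∫ x, h x ∂law = 0) :
    ∃ f ∈ steinDomain, ∀ x, 0 ≤ x → steinOp f x = h x := by
  rw [integral_law] at hmean
  set H : ℝ → ℝ := fun y => ∫ x in (0 : ℝ)..y, h x * density x with hH
  have hHd : ∀ y, HasDerivAt H (h y * density y) y := fun y =>
    (by fun_prop : Continuous fun x => h x * density x).integral_hasStrictDerivAt 0 y |>.hasDerivAt
  have hHc : Continuous H := continuous_iff_continuousAt.2 fun y => (hHd y).continuousAt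
  -- Past the support of `h`, `H` equals the full integral of `h M`, which is the mean of `h`.
  have hHR : ∀ y, R ≤ y → H y = 0 := fun y hy => by
    refine ((intervalIntegral.integral_of_le (hR0.trans hy)).trans ?_).trans hmean
    refine (setIntegral_eq_of_subset_of_forall_sdiff_eq_zero measurableSet_Ioi
      Ioc_subset_Ioi_self fun x hx => ?_).symm
    have : y < x := by
      by_contra! hxy
      exact hx.2 ⟨hx.1, hxy⟩
    rw [hR x (hy.trans this.le), zero_mul]
  -- The truncation `max y 0` keeps `w` continuous on the whole line: nonvanishing of the density is
  -- known only on `[0, ∞)`.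
  set w : ℝ → ℝ := fun y => H y / density (max y 0) ^ 2 with hw
  have hpos : ∀ y, density (max y 0) ≠ 0 := fun y => density_ne_zero (le_max_right _ _)
  have hwc : Continuous w := hHc.div (by fun_prop) fun y => pow_ne_zero 2 (hpos y)
  -- Basing the integral at `R`, where `H` already vanishes, makes `g`, and so `f`, vanish on `[R,
  -- ∞)`.
  set g : ℝ → ℝ := fun x => ∫ y in R..x, w y with hg
  have hgd : ∀ x, HasDerivAt g (w x) x := fun x => (hwc.integral_hasStrictDerivAt R x).hasDerivAt
  have hgR : ∀ x, R ≤ x → g x = 0 := fun x hx => by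
    rw [hg]
    simp only
    rw [intervalIntegral.integral_congr (g := fun _ => (0 : ℝ)), intervalIntegral.integral_zero]
    intro y hy
    rw [uIcc_of_le hx] at hy
    simp only [hw, hHR y hy.1, zero_div]
  set f : ℝ → ℝ := fun x => density x * g x with hf
  set f₁ : ℝ → ℝ := fun x => densityDeriv x * g x + H x / density x with hf₁
  set f₂ : ℝ → ℝ := fun x => 1 / 3 * x * f x + h x with hf₂
  have h₁ : ∀ x ∈ Ici (0 : ℝ), HasDerivWithinAt f (f₁ x) (Ici 0) x := fun x hx => by
    refine (((hasDerivAt_density x).fun_mul (hgd x)).congr_deriv ?_).hasDerivWithinAt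
    have hD := density_ne_zero (show 0 ≤ x from hx)
    simp only [hf₁, hw, max_eq_left (show 0 ≤ x from hx)]
    field_simp
  have h₂ : ∀ x ∈ Ici (0 : ℝ), HasDerivWithinAt f₁ (f₂ x) (Ici 0) x := fun x hx => by
    have hD := density_ne_zero (show 0 ≤ x from hx)
    refine ((((hasDerivAt_densityDeriv x).fun_mul (hgd x)).fun_add
      ((hHd x).fun_div (hasDerivAt_density x) hD)).congr_deriv ?_).hasDerivWithinAt
    simp only [hf₂, hf, hw, max_eq_left (show 0 ≤ x from hx)]
    field_simp
    ring
  have hgc : Continuous g := continuous_iff_continuousAt.2 fun y => (hgd y).continuousAt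
  obtain ⟨hCb, hd, hdd⟩ := isCb2_of_hasDerivWithinAt (R := R) h₁ h₂
    (by simp only [hf₂, hf]; fun_prop) fun x hx => by
      simp [hf₂, hf₁, hf, hgR x hx, hHR x hx, hR x hx]
  refine ⟨f, ⟨hCb, ?_⟩, fun x hx => ?_⟩
  · rw [hd]
    -- Since `H 0 = 0`, the pair `(f 0, f' 0)` is `g 0` times `(M 0, M' 0)`, which satisfies the
    -- boundary condition.
    have hH0 : H 0 = 0 := by simp [hH]
    simp only [hf₁, hf, hH0, density_zero, densityDeriv_zero]
    ring
  · rw [steinOp, hdd x hx]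
    simp only [hf₂]
    ring

/-! ### Determination by mean-zero test functions, and the characterization -/

/-- A probability measure that annihilates every compactly supported continuous function of mean
zero under a probability measure `ν` equals `ν`. -/
theorem eq_of_forall_integral_eq_zero {E : Type*} [TopologicalSpace E] [T2Space E]
    [LocallyCompactSpace E] [MeasurableSpace E] [BorelSpace E] (μ ν : Measure E)
    [IsProbabilityMeasure μ] [IsProbabilityMeasure ν] [μ.Regular] [ν.Regular]
    (H : ∀ h : E → ℝ, Continuous h → HasCompactSupport h → ∫ x, h x ∂ν = 0 → ∫ x, h x ∂μ = 0) :
    μ = ν := by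
  -- A reference function with nonzero `ν`-mean: subtracting a multiple of it gives any test
  -- function mean zero. It follows that `μ` is a multiple of `ν`, and total mass fixes the factor.
  obtain ⟨u, hu⟩ : ∃ u : CompactlySupportedContinuousMap E NNReal, ∫ x, (u x : ℝ) ∂ν ≠ 0 := by
    by_contra! h
    have : ν = 0 := Measure.ext_of_integral_eq_on_compactlySupported_nnreal
      fun f => by rw [h f, integral_zero_measure]
    exact IsProbabilityMeasure.ne_zero ν this
  have hreal : ∀ k : CompactlySupportedContinuousMap E NNReal,
      Continuous (fun x => (k x : ℝ)) ∧ HasCompactSupport (fun x => (k x : ℝ)) := fun k =>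
    ⟨NNReal.continuous_coe.comp k.continuous, k.hasCompactSupport.comp_left NNReal.coe_zero⟩
  have hint : ∀ (k : CompactlySupportedContinuousMap E NNReal) (ρ : Measure E)
      [IsProbabilityMeasure ρ], Integrable (fun x => (k x : ℝ)) ρ := fun k ρ _ =>
    (hreal k).1.integrable_of_hasCompactSupport (hreal k).2
  obtain ⟨c, hc⟩ : ∃ c : NNReal, (c : ℝ) = (∫ x, (u x : ℝ) ∂μ) / ∫ x, (u x : ℝ) ∂ν :=
    ⟨_, Real.coe_toNNReal _ (div_nonneg (integral_nonneg fun _ => NNReal.coe_nonneg _)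
      (integral_nonneg fun _ => NNReal.coe_nonneg _))⟩
  have hμ : μ = c • ν := by
    refine Measure.ext_of_integral_eq_on_compactlySupported_nnreal fun k => ?_
    set r : ℝ := (∫ x, (k x : ℝ) ∂ν) / ∫ x, (u x : ℝ) ∂ν with hr
    have h0 := H (fun x => (k x : ℝ) - r * u x) ((hreal k).1.sub ((hreal u).1.const_mul r))
      ((hreal k).2.sub (hreal u).2.mul_left)
    rw [integral_sub (hint k ν) ((hint u ν).const_mul r), integral_const_mul,
      integral_sub (hint k μ) ((hint u μ).const_mul r), integral_const_mul] at h0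
    have h1 := h0 (by rw [hr]; field_simp; ring)
    rw [integral_smul_nnreal_measure, NNReal.smul_def, smul_eq_mul, hc]
    rw [hr] at h1
    rw [sub_eq_zero.1 h1]
    ring
  have h1 := congrArg (fun ρ : Measure E => ρ univ) hμ
  simp only [measure_univ, Measure.smul_apply, ENNReal.smul_def, smul_eq_mul, mul_one] at h1
  have hc1 : c = 1 := by exact_mod_cast h1.symm
  rw [hμ, hc1, one_smul]

end MWright

end

theorem theorem1 {Ω : Type*} [MeasurableSpace Ω] (P : Measure Ω) [IsProbabilityMeasure P]
    (X : Ω → ℝ) (hX : AEMeasurable X P) (hpos : ∀ᵐ ω ∂P, 0 ≤ X ω) :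
    P.map X = MWright.law ↔
      ∀ f ∈ MWright.steinDomain,
        Integrable (fun ω => MWright.steinOp f (X ω)) P ∧
          ∫ ω, MWright.steinOp f (X ω) ∂P = 0 := by
  constructor
  · intro hlaw f hf
    have hint := MWright.integrable_steinOp_law hf.1
    have h0 := MWright.integral_steinOp_law hf
    rw [← hlaw] at hint h0
    rw [integral_map hX hint.aestronglyMeasurable] at h0
    exact ⟨(integrable_map_measure hint.aestronglyMeasurable hX).1 hint, h0⟩
  · intro H
    have : IsProbabilityMeasure (P.map X) := Measure.isProbabilityMeasure_map hX
    refine MWright.eq_of_forall_integral_eq_zero _ _ fun h hh hcs hmean => ?_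
    obtain ⟨R, hR0, hR⟩ : ∃ R : ℝ, 0 ≤ R ∧ ∀ x, R ≤ x → h x = 0 := by
      obtain ⟨R, hR⟩ := hcs.isCompact.bddAbove
      -- `R` bounds the support, where `h R` may be nonzero; `R + 1` lies strictly beyond it.
      refine ⟨max (R + 1) 0, le_max_right _ _, fun x hx => ?_⟩
      by_contra hne
      have h1 := hR (subset_tsupport h hne)
      linarith [(le_max_left (R + 1) 0).trans hx]
    obtain ⟨f, hf, hfh⟩ := MWright.exists_steinOp_eq hh hR0 hR hmean
    rw [integral_map hX hh.aestronglyMeasurable, ← (H f hf).2]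
    refine integral_congr_ae ?_
    -- The Stein equation holds only on `[0, ∞)`, which contains `X ω` almost surely.
    filter_upwards [hpos] with ω hω
    exact (hfh _ hω).symm
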